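/- Let $\mathcal B$ consist of all subsets $B\subset\{1,\dots,10\}$ of size $|B|=4$ except for $$\{1,2,3,4\},\ \{1,2,5,6\},\ \{1,2,7,8\},\ \{1,2,9,10\},\ \{3,4,5,6\},\ \{5,6,7,8\}\ \text{ and }\ \{7,8,9,10\}.$$ Then $\mathcal B$ is the collection of bases of a rank-four matroid $V_{10}$ on $\{1,\dots,10\}$, and its basis generating polynomial $$f_{10}(x)=\sum_{B\in\mathcal B}\ \prod_{i\in B}x_i\ \in\ \mathbb R[x_1,\dots,x_{10}]_4,$$ which is homogeneous of degree $4$, is stable: for all $v\in(\mathbb R_{>0})^{10}$ and $w\in\mathbb R^{10}$, every complex root of the univariate polynomial $f_{10}(tv+w)\in\mathbb R[t]$ is real. That is, $V_{10}$ has the half-plane property. Furthermore, no power of $f_{10}$ has a definite determinantal representation: for no integers $k\ge 1$ and $d\ge 0$ do there exist positive semidefinite Hermitian matrices $A_1,\dots,A_{10}\in\mathbb C^{d\times d}$ with $$f_{10}(x)^k=\det(x_1A_1+\dots+x_{10}A_{10}).$$ -/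

import Mathlib

open scoped ComplexOrder

/-- The basis generating polynomial `∑_B ∏_{i ∈ B} x_i` of a matroid `M` on a finite type,
where `B` runs over the bases of `M`. -/
noncomputable def Matroid.basisGenPoly {α : Type*} [Fintype α] (M : Matroid α) :
    MvPolynomial α ℝ :=
  open Classical in
  ∑ B ∈ (Finset.univ : Finset (Finset α)) with M.IsBase (B : Set α), ∏ i ∈ B, MvPolynomial.X i

/-- The univariate polynomial `f(t v + w) ∈ ℝ[t]`. -/
noncomputable def MvPolynomial.restrictToLine {α : Type*} (f : MvPolynomial α ℝ) (v w : α → ℝ) :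
    Polynomial ℝ :=
  MvPolynomial.aeval
    (fun i => Polynomial.C (v i) * Polynomial.X + Polynomial.C (w i) : α → Polynomial ℝ) f

/-- A real (homogeneous) polynomial `f` is stable if for all `v ∈ (ℝ_{>0})^n` and `w ∈ ℝ^n` the
univariate polynomial `f(t v + w)` has only real roots, i.e. every complex root is real. -/
def MvPolynomial.IsStable {α : Type*} (f : MvPolynomial α ℝ) : Prop :=
  ∀ v w : α → ℝ, (∀ i, 0 < v i) →
    ∀ z : ℂ, Polynomial.aeval z (f.restrictToLine v w) = 0 → z.im = 0

/-- A matroid has the half-plane property if its basis generating polynomial is stable. -/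
def Matroid.HasHalfPlaneProperty {α : Type*} [Fintype α] (M : Matroid α) : Prop :=
  M.basisGenPoly.IsStable

/-- `f` has a definite determinantal representation: `f = det (∑ i, x_i A_i)` for positive
semidefinite (complex Hermitian) matrices `A_i` of some size `d`. -/
def MvPolynomial.HasDefiniteDetRep {α : Type*} [Fintype α] (f : MvPolynomial α ℝ) : Prop :=
  ∃ (d : ℕ) (A : α → Matrix (Fin d) (Fin d) ℂ), (∀ i, (A i).PosSemidef) ∧
    MvPolynomial.map Complex.ofRealHom f =
      (∑ i, (MvPolynomial.X i : MvPolynomial α ℂ) • (A i).map MvPolynomial.C).det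

/-- The seven excluded `4`-subsets
`{1,2,3,4}, {1,2,5,6}, {1,2,7,8}, {1,2,9,10}, {3,4,5,6}, {5,6,7,8}, {7,8,9,10}`
of `{1, …, 10}`; the element `j` of `{1, …, 10}` is represented by `j - 1 : Fin 10`. -/
def vamosTenNonbases : Finset (Finset (Fin 10)) :=
  {{0, 1, 2, 3}, {0, 1, 4, 5}, {0, 1, 6, 7}, {0, 1, 8, 9}, {2, 3, 4, 5}, {4, 5, 6, 7},
    {6, 7, 8, 9}}

/-- All `4`-subsets of the ten element ground set except for the seven excluded ones. -/
def vamosTenBases : Finset (Finset (Fin 10)) :=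
  Finset.powersetCard 4 Finset.univ \ vamosTenNonbases

/-- The polynomial `f₁₀ = ∑_B ∏_{i ∈ B} x_i`. -/
noncomputable def vamosTenPoly : MvPolynomial (Fin 10) ℝ :=
  ∑ B ∈ vamosTenBases, ∏ i ∈ B, MvPolynomial.X i

/-!
The matroid `V₁₀` is sparse paving: any two of the seven excluded sets share at most two elements,
so an exchange that fails for one element succeeds for any other.

Stability. A real polynomial without zeros in a power of the open upper half-plane is stable. The
polynomial `f₁₀` is multiaffine and symmetric in each of the pairs of variables `{1,2}, …,
{9,10}`, so by Grace–Walsh–Szegő (`exists_quadratic_root_of_polarization`) it is enough to exclude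
zeros at points whose coordinates agree on every pair. There `f₁₀` equals `4 e₁ e₃ + N` in five
variables `s, a, b, c, d`, with `N = a²c² + a²d² + b²d²`. The polynomial `4 e₁ e₃` has no such
zeros, by Gauss–Lucas. Along the deformation `4 e₁ e₃ + ε N`, with `s` fixed in the upper
half-plane and `(a, b, c, d)` on a line `x + t y`, `y > 0`, a zero `t` could enter the upper
half-plane only through a real value of `t` (`eval_add_ne_zero_of_segment`). But for real `a, b,
c, d` the deformed polynomial is a quadratic in `s` whose discriminant is nonnegative, so that its
zeros `s` are real. The discriminant inequality `e₂ N ≤ (e₁ e₂ - e₃)²` (`disc_nonneg`), where now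
`e₁, e₂, e₃` are taken in `a, b, c, d` only, follows from an explicit certificate `σ₀ + e₂ σ₁` with
sums of squares `σ₀, σ₁`. Lines on which the
quadratic may vanish identically are avoided by a small perturbation.

Determinantal representations. If `f₁₀ ^ k = det (∑ xᵢ Aᵢ)` with positive semidefinite `Aᵢ`, then
after a congruence `∑ Aᵢ = 1`, and the dimension of the kernel of `∑_{i ∈ S} Aᵢ`, which is the
intersection of the kernels of the summands, is `k` times the order of vanishing of `f₁₀` at `-1_S`
in the direction `1`. The pairs `{1,2}`, `{5,6}`, `{3,4}`, `{7,8}` thus give four subspaces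
whose dimensions are those of the dual of a Vámos configuration multiplied by `k`, and linear
algebra forbids this (`Submodule.no_dual_vamos_configuration`).
-/

/-! ### The matroid -/

/-- Sparse paving matroids: if the members of `𝒩` pairwise share at most `r - 2` elements, then the
`r`-sets outside `𝒩` have the exchange property. The bound is needed only for `N ≠ N'`, and members
of `𝒩` of size other than `r` are harmless. -/
theorem exchangeProperty_of_sparse {α : Type*} [DecidableEq α] {r : ℕ} (𝒩 : Finset (Finset α))
    (h𝒩 : ∀ N ∈ 𝒩, ∀ N' ∈ 𝒩, N ≠ N' → (N ∩ N').card + 2 ≤ r) :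
    Matroid.ExchangeProperty
      fun S : Set α ↦ ∃ B : Finset α, (B.card = r ∧ B ∉ 𝒩) ∧ (B : Set α) = S := by
  rintro _ _ ⟨B, ⟨hB, hB𝒩⟩, rfl⟩ ⟨B', ⟨hB', hB'𝒩⟩, rfl⟩ a ha
  have haB : a ∈ B := by simpa using ha.1
  have haB' : a ∉ B' := by simpa using ha.2
  have hswap : ∀ b ∈ B' \ B, (insert b (B.erase a)).card = r := by
    intro b hb
    rw [Finset.card_insert_of_notMem (by simp_all), Finset.card_erase_add_one haB, hB]
  -- It suffices to find an element of `B' \ B` whose exchange for `a` is not an excluded set.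
  suffices h : ∃ b ∈ B' \ B, insert b (B.erase a) ∉ 𝒩 by
    obtain ⟨b, hb, hb𝒩⟩ := h
    exact ⟨b, by simpa using hb, insert b (B.erase a), ⟨hswap b hb, hb𝒩⟩, by simp⟩
  by_contra! hall
  have hcard : (B' \ B).card = (B \ B').card := Finset.card_sdiff_comm (hB'.trans hB.symm)
  have haBB' : a ∈ B \ B' := by simp [haB, haB']
  obtain ⟨b, hb⟩ : (B' \ B).Nonempty :=
    Finset.card_pos.mp (hcard ▸ Finset.card_pos.mpr ⟨a, haBB'⟩)
  by_cases hone : ∃ c ∈ B' \ B, c ≠ b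
  · -- Two different exchanges would be excluded sets sharing the `r - 1` elements of `B \ {a}`.
    obtain ⟨c, hc, hcb⟩ := hone
    have hne : insert b (B.erase a) ≠ insert c (B.erase a) := by
      intro h
      have : c ∈ insert b (B.erase a) := h ▸ Finset.mem_insert_self c _
      rcases Finset.mem_insert.mp this with h | h
      · exact hcb h
      · exact (Finset.mem_sdiff.mp hc).2 (Finset.mem_of_mem_erase h)
    have hle := h𝒩 _ (hall b hb) _ (hall c hc) hne
    have hsub : B.erase a ⊆ insert b (B.erase a) ∩ insert c (B.erase a) :=
      Finset.subset_inter (Finset.subset_insert _ _) (Finset.subset_insert _ _)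
    have := Finset.card_le_card hsub
    have := Finset.card_erase_add_one haB
    omega
  · -- Otherwise `B' \ B = {b}`, and the exchange is `B'` itself.
    push Not at hone
    have h1 : B' \ B = {b} := Finset.eq_singleton_iff_unique_mem.mpr ⟨hb, hone⟩
    have h2 : B \ B' = {a} :=
      (Finset.card_eq_one.mp (by rw [← hcard, h1, Finset.card_singleton])).elim fun x hx ↦ by
        rw [hx] at haBB' ⊢
        rw [Finset.mem_singleton.mp haBB']
    have : insert b (B.erase a) = B' := by
      ext x
      have e1 : x ∈ B' \ B ↔ x = b := by rw [h1, Finset.mem_singleton]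
      have e2 : x ∈ B \ B' ↔ x = a := by rw [h2, Finset.mem_singleton]
      simp only [Finset.mem_sdiff] at e1 e2
      simp only [Finset.mem_insert, Finset.mem_erase]
      tauto
    exact hB'𝒩 (this ▸ hall b hb)

theorem mem_vamosTenBases {B : Finset (Fin 10)} :
    B ∈ vamosTenBases ↔ B.card = 4 ∧ B ∉ vamosTenNonbases := by
  simp [vamosTenBases, Finset.mem_powersetCard]

set_option maxRecDepth 4000 in
/-- The matroid `V₁₀`, given by its bases; it is sparse paving, since any two of the seven excluded
sets meet in at most two elements. -/
def vamosTenMatroid : Matroid (Fin 10) :=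
  Matroid.ofIsBaseOfFinite (E := Set.univ) Set.finite_univ
    (fun S ↦ ∃ B : Finset (Fin 10), (B.card = 4 ∧ B ∉ vamosTenNonbases) ∧ (B : Set (Fin 10)) = S)
    ⟨_, {0, 2, 4, 6}, by decide, rfl⟩
    (exchangeProperty_of_sparse vamosTenNonbases (by decide +kernel))
    (fun _ _ ↦ Set.subset_univ _)

theorem vamosTenMatroid_isBase (S : Set (Fin 10)) :
    vamosTenMatroid.IsBase S ↔ ∃ B ∈ vamosTenBases, (B : Set (Fin 10)) = S := by
  simp [vamosTenMatroid, mem_vamosTenBases]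

theorem vamosTenMatroid_eRank : vamosTenMatroid.eRank = 4 := by
  have hB : vamosTenMatroid.IsBase (({0, 2, 4, 6} : Finset (Fin 10)) : Set (Fin 10)) :=
    (vamosTenMatroid_isBase _).mpr ⟨_, mem_vamosTenBases.mpr (by decide), rfl⟩
  rw [← hB.encard_eq_eRank, Set.encard_coe_eq_coe_finsetCard]
  simp

/-- The sum defining `Matroid.basisGenPoly` runs over coercions of finsets to sets; this turns it
into a sum over a given finset of bases. -/
theorem Matroid.basisGenPoly_eq_sum {α : Type*} [Fintype α] (M : Matroid α)
    (ℬ : Finset (Finset α)) (hℬ : ∀ S : Set α, M.IsBase S ↔ ∃ B ∈ ℬ, (B : Set α) = S) :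
    M.basisGenPoly = ∑ B ∈ ℬ, ∏ i ∈ B, MvPolynomial.X i := by
  classical
  rw [Matroid.basisGenPoly]
  symm
  refine Finset.sum_bij (fun B _ ↦ (B : Set α)) (fun B hB ↦ ?_)
    (fun B _ C _ h ↦ Finset.coe_injective h) (fun S hS ↦ ?_) (fun B _ ↦ ?_)
  · simp only [Finset.mem_filter]
    refine ⟨?_, (hℬ _).mpr ⟨B, hB, rfl⟩⟩
    simp [Finset.bind_def]
  · simp only [Finset.mem_filter] at hS
    obtain ⟨B, hB, rfl⟩ := (hℬ S).mp hS.2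
    exact ⟨B, hB, rfl⟩
  · simp

theorem vamosTenPoly_isHomogeneous : vamosTenPoly.IsHomogeneous 4 := by
  refine MvPolynomial.IsHomogeneous.sum _ _ _ fun B hB ↦ ?_
  have := MvPolynomial.IsHomogeneous.prod B (fun i ↦ (MvPolynomial.X i : MvPolynomial (Fin 10) ℝ))
    (fun _ ↦ 1) fun i _ ↦ MvPolynomial.isHomogeneous_X ℝ i
  simpa [(mem_vamosTenBases.mp hB).1] using this

/-! ### The polynomial in terms of sums and products of pairs -/

/-- Recursion for elementary symmetric polynomials: `e_{n+1}(x, x_a) = e_{n+1}(x) + x_a e_n(x)`. -/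
theorem sum_powersetCard_insert_prod {α R : Type*} [DecidableEq α] [CommSemiring R] (x : α → R)
    {a : α} {s : Finset α} (h : a ∉ s) (n : ℕ) :
    ∑ B ∈ (insert a s).powersetCard (n + 1), ∏ i ∈ B, x i =
      ∑ B ∈ s.powersetCard (n + 1), ∏ i ∈ B, x i +
        x a * ∑ B ∈ s.powersetCard n, ∏ i ∈ B, x i := by
  rw [Finset.powersetCard_succ_insert h, Finset.sum_union, Finset.sum_image, Finset.mul_sum]
  · congr 1
    refine Finset.sum_congr rfl fun B hB ↦ Finset.prod_insert fun ha ↦ ?_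
    exact h ((Finset.mem_powersetCard.mp hB).1 ha)
  · intro B hB C hC hBC
    have hB' : a ∉ B := fun ha ↦ h ((Finset.mem_powersetCard.mp hB).1 ha)
    have hC' : a ∉ C := fun ha ↦ h ((Finset.mem_powersetCard.mp hC).1 ha)
    rw [← Finset.erase_insert hB', ← Finset.erase_insert hC', hBC]
  · rw [Finset.disjoint_left]
    rintro B hB hB'
    obtain ⟨C, -, rfl⟩ := Finset.mem_image.mp hB'
    exact h ((Finset.mem_powersetCard.mp hB).1 (Finset.mem_insert_self a C))

/-- The polynomial `f₁₀` in terms of the sums `sᵢ` and the products `pᵢ` of the five pairs of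
variables `{1,2}, …, {9,10}`. Without the exclusions it would be the coefficient of `T⁴` in `∏ᵢ (1
+ sᵢ T + pᵢ T²)`; the exclusions cancel seven of the ten terms `pᵢ pⱼ`. It is affine in each `(sᵢ,
pᵢ)`. -/
def pairPoly {R : Type*} [CommSemiring R] (s₁ s₂ s₃ s₄ s₅ p₁ p₂ p₃ p₄ p₅ : R) : R :=
  s₁ * s₂ * s₃ * s₄ + s₁ * s₂ * s₃ * s₅ + s₁ * s₂ * s₄ * s₅ + s₁ * s₃ * s₄ * s₅ +
    s₂ * s₃ * s₄ * s₅ +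
  p₁ * (s₂ * s₃ + s₂ * s₄ + s₂ * s₅ + s₃ * s₄ + s₃ * s₅ + s₄ * s₅) +
  p₂ * (s₁ * s₃ + s₁ * s₄ + s₁ * s₅ + s₃ * s₄ + s₃ * s₅ + s₄ * s₅) +
  p₃ * (s₁ * s₂ + s₁ * s₄ + s₁ * s₅ + s₂ * s₄ + s₂ * s₅ + s₄ * s₅) +
  p₄ * (s₁ * s₂ + s₁ * s₃ + s₁ * s₅ + s₂ * s₃ + s₂ * s₅ + s₃ * s₅) +
  p₅ * (s₁ * s₂ + s₁ * s₃ + s₁ * s₄ + s₂ * s₃ + s₂ * s₄ + s₃ * s₄) +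
  p₂ * p₄ + p₂ * p₅ + p₃ * p₅

set_option maxRecDepth 4000 in
set_option maxHeartbeats 1000000 in
theorem sum_vamosTenBases_prod {R : Type*} [CommRing R] (x : Fin 10 → R) :
    ∑ B ∈ vamosTenBases, ∏ i ∈ B, x i =
      pairPoly (x 0 + x 1) (x 2 + x 3) (x 4 + x 5) (x 6 + x 7) (x 8 + x 9)
        (x 0 * x 1) (x 2 * x 3) (x 4 * x 5) (x 6 * x 7) (x 8 * x 9) := by
  have hsub : vamosTenNonbases ⊆ Finset.powersetCard 4 Finset.univ := by
    intro B hB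
    have : ∀ B ∈ vamosTenNonbases, B.card = 4 := by decide +kernel
    simpa [Finset.mem_powersetCard] using this B hB
  have hnon : ∑ B ∈ vamosTenNonbases, ∏ i ∈ B, x i =
      x 0 * x 1 * x 2 * x 3 + x 0 * x 1 * x 4 * x 5 + x 0 * x 1 * x 6 * x 7 +
      x 0 * x 1 * x 8 * x 9 + x 2 * x 3 * x 4 * x 5 + x 4 * x 5 * x 6 * x 7 +
      x 6 * x 7 * x 8 * x 9 := by
    rw [vamosTenNonbases]
    repeat rw [Finset.sum_insert (by decide)]
    rw [Finset.sum_singleton]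
    simp (disch := decide) only [Finset.prod_insert, Finset.prod_singleton]
    ring
  have huniv : (Finset.univ : Finset (Fin 10)) =
      insert 0 (insert 1 (insert 2 (insert 3 (insert 4 (insert 5 (insert 6 (insert 7
        (insert 8 (insert 9 ∅))))))))) := by decide
  have hs : ∀ (n : ℕ) (s : Finset (Fin 10)), s.card < n + 1 →
      ∑ B ∈ s.powersetCard (n + 1), ∏ i ∈ B, x i = 0 := by
    intro n s h
    rw [Finset.powersetCard_eq_empty.mpr h, Finset.sum_empty]
  have hall : ∑ B ∈ Finset.powersetCard 4 Finset.univ, ∏ i ∈ B, x i =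
      ∑ B ∈ vamosTenBases, ∏ i ∈ B, x i + ∑ B ∈ vamosTenNonbases, ∏ i ∈ B, x i := by
    rw [vamosTenBases, Finset.sum_sdiff hsub]
  rw [← sub_eq_iff_eq_add, hnon, huniv] at hall
  rw [← hall]
  simp (disch := decide) only [sum_powersetCard_insert_prod, Finset.powersetCard_zero,
    Finset.sum_singleton, Finset.prod_empty, hs]
  rw [pairPoly]
  ring

/-! ### Grace–Walsh–Szegő for two variables -/

/-- Inversion maps the half-plane `{u | h ≤ im u}`, `h = im x > 0`, into the disc
`h |s|² ≤ -im s`. -/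
theorem im_inv_sub_le {x r : ℂ} (hx : 0 < x.im) (hr : r.im ≤ 0) :
    x.im * Complex.normSq (x - r)⁻¹ ≤ -((x - r)⁻¹).im := by
  have h : 0 < (x - r).im := by rw [Complex.sub_im]; linarith
  have hn : 0 < Complex.normSq (x - r) := Complex.normSq_pos.mpr fun h0 ↦ by simp [h0] at h
  rw [Complex.normSq_inv, Complex.inv_im, neg_div, neg_neg, ← div_eq_mul_inv]
  gcongr
  rw [Complex.sub_im]
  linarith

/-- The Grace–Walsh–Szegő theorem for a symmetric multiaffine polynomial in two variables and the
upper half-plane. If both roots `r, r'` of the quadratic were outside the half-plane, then `x - y`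
would be the harmonic mean of `x - r` and `x - r'`, hence have imaginary part at least `im x`, so
that `im y ≤ 0`. -/
theorem exists_quadratic_root_of_polarization {A B C x y : ℂ} (hx : 0 < x.im) (hy : 0 < y.im)
    (h : A * (x * y) + B * (x + y) + C = 0) :
    ∃ z : ℂ, 0 < z.im ∧ A * z ^ 2 + B * (2 * z) + C = 0 := by
  by_cases hA : A = 0
  · refine ⟨(x + y) / 2, ?_, by rw [← h, hA]; ring⟩
    have : (x + y) / 2 = ((1 / 2 : ℝ) : ℂ) * (x + y) := by push_cast; ring
    rw [this, Complex.im_ofReal_mul, Complex.add_im]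
    linarith
  obtain ⟨δ, hδ⟩ := IsAlgClosed.exists_pow_nat_eq (B ^ 2 - A * C) (n := 2) (by norm_num)
  set r : ℂ := (-B + δ) / A with hr
  set r' : ℂ := (-B - δ) / A with hr'
  have hsum : A * (r + r') = -2 * B := by rw [hr, hr']; field_simp; ring
  have hprod : A * (r * r') = C := by
    rw [hr, hr']; field_simp; linear_combination -hδ
  have hroot : ∀ z, A * z ^ 2 + B * (2 * z) + C = A * ((z - r) * (z - r')) := by
    intro z; linear_combination z * hsum - hprod
  by_contra! hne
  have him : r.im ≤ 0 := by
    by_contra! hpos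
    exact hne r hpos (by rw [hroot]; ring)
  have him' : r'.im ≤ 0 := by
    by_contra! hpos
    exact hne r' hpos (by rw [hroot]; ring)
  have hxr : x - r ≠ 0 := fun h0 ↦ by
    have := congrArg Complex.im h0; rw [Complex.sub_im, Complex.zero_im] at this; linarith
  have hxr' : x - r' ≠ 0 := fun h0 ↦ by
    have := congrArg Complex.im h0; rw [Complex.sub_im, Complex.zero_im] at this; linarith
  have hpol : (x - r) * (y - r') + (x - r') * (y - r) = 0 := by
    apply mul_left_cancel₀ hA
    linear_combination 2 * h - (x + y) * hsum + 2 * hprod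
  set s : ℂ := (x - r)⁻¹ + (x - r')⁻¹ with hs
  have hkey : (x - y) * s = 2 := by
    rw [hs]; field_simp; linear_combination -hpol
  have hs1 := im_inv_sub_le hx him
  have hs2 := im_inv_sub_le hx him'
  -- `s / 2` is the midpoint of two points of the disc `x.im * |s|² ≤ -s.im`, which is convex.
  have hs3 : x.im * Complex.normSq s ≤ -2 * s.im := by
    have hpar : Complex.normSq s ≤
        2 * Complex.normSq (x - r)⁻¹ + 2 * Complex.normSq (x - r')⁻¹ := by
      rw [hs]
      simp only [Complex.normSq_apply, Complex.add_re, Complex.add_im]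
      nlinarith [sq_nonneg (((x - r)⁻¹).re - ((x - r')⁻¹).re),
        sq_nonneg (((x - r)⁻¹).im - ((x - r')⁻¹).im)]
    have : s.im = ((x - r)⁻¹).im + ((x - r')⁻¹).im := by rw [hs, Complex.add_im]
    nlinarith
  have hs0 : s ≠ 0 := fun h0 ↦ by simp [h0] at hkey
  have hn : 0 < Complex.normSq s := Complex.normSq_pos.mpr hs0
  have hxy : x - y = 2 * s⁻¹ := by field_simp; exact hkey
  have him2 : x.im - y.im = -2 * s.im / Complex.normSq s := by
    have := congrArg Complex.im hxy
    rw [Complex.sub_im, show (2 : ℂ) * s⁻¹ = ((2 : ℝ) : ℂ) * s⁻¹ by norm_num,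
      Complex.im_ofReal_mul, Complex.inv_im] at this
    rw [this]; ring
  have : x.im ≤ -2 * s.im / Complex.normSq s := (le_div_iff₀ hn).mpr hs3
  linarith

/-! ### The discriminant inequality -/

/-- Nonnegativity of the discriminant of the diagonal polynomial in its first variable. With `e₂`
and `e₃` the elementary symmetric polynomials and `N` the sum over the three non-excluded pairs,
the claim is `e₂ N ≤ (e₁ e₂ - e₃)²`. The difference is not a sum of squares, but it has the form
`σ₀ + e₂ σ₁` with `σ₀, σ₁` sums of squares, which suffices because only `0 ≤ e₂` is at issue. -/
theorem disc_nonneg (a b c d : ℝ) :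
    (a * b + a * c + a * d + b * c + b * d + c * d) *
        (a ^ 2 * c ^ 2 + a ^ 2 * d ^ 2 + b ^ 2 * d ^ 2) ≤
      ((a + b + c + d) * (a * b + a * c + a * d + b * c + b * d + c * d) -
        (a * b * c + a * b * d + a * c * d + b * c * d)) ^ 2 := by
  set E := a * b + a * c + a * d + b * c + b * d + c * d with hE
  have hN : 0 ≤ a ^ 2 * c ^ 2 + a ^ 2 * d ^ 2 + b ^ 2 * d ^ 2 := by positivity
  rcases le_total E 0 with h | h
  · exact (mul_nonpos_of_nonpos_of_nonneg h hN).trans (sq_nonneg _)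
  set u := a ^ 2 * (b + c + d) - b * c * d with hu
  set v := b ^ 2 * (a + c + d) - a * c * d with hv
  set w := c ^ 2 * (a + b + d) - a * b * d with hw
  set z := d ^ 2 * (a + b + c) - a * b * c with hz
  set M := a * b * c + a * b * d + a * c * d + b * c * d with hM
  set B := a ^ 2 * (b + c + d) + b ^ 2 * (a + c + d) + c ^ 2 * (a + b + d) +
    d ^ 2 * (a + b + c) with hB
  -- The last summand is the same for all orderings of the variables; only the cofactor of `E` sees
  -- which of the six products `xᵢ² xⱼ²` occur on the left.
  have key : ((a + b + c + d) * E - M) ^ 2 =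
      E * (a ^ 2 * c ^ 2 + a ^ 2 * d ^ 2 + b ^ 2 * d ^ 2) +
      E * ((a * b - c * d) ^ 2 + b ^ 2 * c ^ 2) +
      (1 / 8 * ((u - v) ^ 2 + (u - w) ^ 2 + (u - z) ^ 2 + (v - w) ^ 2 + (v - z) ^ 2 +
        (w - z) ^ 2) + 5 / 8 * (B + 3 * M) ^ 2 + M ^ 2) := by
    rw [hu, hv, hw, hz, hB, hM, hE]; ring
  have h1 : 0 ≤ E * ((a * b - c * d) ^ 2 + b ^ 2 * c ^ 2) := by positivity
  have h2 : 0 ≤ 1 / 8 * ((u - v) ^ 2 + (u - w) ^ 2 + (u - z) ^ 2 + (v - w) ^ 2 + (v - z) ^ 2 +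
        (w - z) ^ 2) + 5 / 8 * (B + 3 * M) ^ 2 + M ^ 2 := by positivity
  linarith

/-! ### Zeros of polynomials and half-planes -/

/-- A polynomial which is small at `z` compared with its leading coefficient has a root near `z`. -/
theorem Polynomial.exists_isRoot_near {p : Polynomial ℂ} {z : ℂ} {δ : ℝ}
    (hδ : 0 < δ) (h : ‖p.eval z‖ < ‖p.leadingCoeff‖ * δ ^ p.natDegree) :
    ∃ r, p.eval r = 0 ∧ ‖r - z‖ < δ := by
  by_contra! hall
  refine h.not_ge ?_
  have hs := IsAlgClosed.splits p
  have hp : p ≠ 0 := by rintro rfl; simp at h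
  rw [hs.eval_eq_prod_roots, norm_mul, hs.natDegree_eq_card_roots]
  refine mul_le_mul_of_nonneg_left ?_ (norm_nonneg _)
  have : ∀ m : Multiset ℂ, (∀ r ∈ m, δ ≤ ‖z - r‖) →
      δ ^ m.card ≤ ‖(m.map fun r ↦ z - r).prod‖ := by
    intro m
    induction m using Multiset.induction with
    | empty => simp
    | cons r m ih =>
      intro hm
      rw [Multiset.card_cons, Multiset.map_cons, Multiset.prod_cons, norm_mul, pow_succ']
      exact mul_le_mul (hm r (Multiset.mem_cons_self r m))
        (ih fun r' hr' ↦ hm r' (Multiset.mem_cons_of_mem hr')) (by positivity) (norm_nonneg _)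
  refine this _ fun r hr ↦ ?_
  rw [norm_sub_rev]
  exact hall r ((Polynomial.mem_roots hp).mp hr)

open Polynomial in
/-- Gauss–Lucas for the open lower half-plane. -/
theorem im_neg_of_eval_derivative_eq_zero {P : ℂ[X]} (hP : 0 < P.natDegree)
    (h : ∀ z, P.eval z = 0 → z.im < 0) {z : ℂ} (hz : P.derivative.eval z = 0) : z.im < 0 := by
  have hP' : P.derivative ≠ 0 := fun h0 ↦
    hP.ne' (Polynomial.derivative_eq_zero.mp h0)
  have hmem : z ∈ P.derivative.rootSet ℂ := by
    rw [Polynomial.mem_rootSet]; exact ⟨hP', by simpa using hz⟩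
  have hsub : P.rootSet ℂ ⊆ {z : ℂ | z.im < 0} := by
    intro w hw
    rw [Polynomial.mem_rootSet] at hw
    exact h w (by simpa using hw.2)
  exact convexHull_min hsub (convex_halfSpace_im_lt 0)
    (rootSet_derivative_subset_convexHull_rootSet (Polynomial.natDegree_pos_iff_degree_pos.mp hP)
      hmem)

open Polynomial in
/-- The elementary symmetric polynomial `e₃` of five points of the upper half-plane does not vanish:
`2 e₃` is the value at `0` of the second derivative of the polynomial with roots `-s, -a, …, -d`. -/
theorem esymm_three_ne_zero {s a b c d : ℂ} (hs : 0 < s.im) (ha : 0 < a.im) (hb : 0 < b.im)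
    (hc : 0 < c.im) (hd : 0 < d.im) :
    s * (a * b + a * c + a * d + b * c + b * d + c * d) +
      (a * b * c + a * b * d + a * c * d + b * c * d) ≠ 0 := by
  intro h
  set P : ℂ[X] := (X + C s) * (X + C a) * (X + C b) * (X + C c) * (X + C d) with hP
  have hroot : ∀ z, P.eval z = 0 → z.im < 0 := by
    intro z hz
    simp only [hP, eval_mul, eval_add, eval_X, eval_C, mul_eq_zero] at hz
    have key : ∀ w : ℂ, 0 < w.im → z + w = 0 → z.im < 0 := by
      intro w hw h0
      have := congrArg Complex.im h0
      rw [Complex.add_im, Complex.zero_im] at this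
      linarith
    rcases hz with (((hz | hz) | hz) | hz) | hz
    exacts [key s hs hz, key a ha hz, key b hb hz, key c hc hz, key d hd hz]
  have hdeg : P.natDegree = 5 := by rw [hP]; compute_degree!
  have hdeg' : P.derivative.natDegree = 4 := by rw [natDegree_derivative, hdeg]
  have h1 : ∀ z, P.derivative.eval z = 0 → z.im < 0 := fun z hz ↦
    im_neg_of_eval_derivative_eq_zero (by rw [hdeg]; norm_num) hroot hz
  have h2 := im_neg_of_eval_derivative_eq_zero (z := 0) (by rw [hdeg']; norm_num) h1 (by
    simp only [hP, derivative_mul, derivative_add, derivative_X, derivative_C, eval_mul,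
      eval_add, eval_X, eval_C, eval_one, eval_zero, derivative_one, derivative_zero]
    linear_combination 2 * h)
  simp at h2

open Polynomial in
/-- Homotopy principle: along the segment `q + ε r`, `ε ∈ [0, 1]`, with constant degree and leading
coefficient bounded away from zero, zeros can enter the upper half-plane only through the real
axis. -/
theorem eval_add_ne_zero_of_segment {q r : ℂ[X]} {n : ℕ} {l : ℝ} (hl : 0 < l)
    (hdeg : ∀ ε ∈ Set.Icc (0 : ℝ) 1, (q + C (ε : ℂ) * r).natDegree = n)
    (hlead : ∀ ε ∈ Set.Icc (0 : ℝ) 1, l ≤ ‖(q + C (ε : ℂ) * r).leadingCoeff‖)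
    (hreal : ∀ ε ∈ Set.Icc (0 : ℝ) 1, ∀ t : ℝ, (q + C (ε : ℂ) * r).eval (t : ℂ) ≠ 0)
    (h0 : ∀ t : ℂ, 0 < t.im → q.eval t ≠ 0) {t : ℂ} (ht : 0 < t.im) : (q + r).eval t ≠ 0 := by
  set F : ℝ → ℂ → ℂ := fun ε t ↦ q.eval t + ε * r.eval t with hF
  have hFe : ∀ (ε : ℝ) (t : ℂ), (q + C (ε : ℂ) * r).eval t = F ε t := by
    intro ε t; simp [hF]
  have hFc : Continuous fun x : ℝ × ℂ ↦ F x.1 x.2 := by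
    simp only [hF]
    have hq : Continuous fun x : ℝ × ℂ ↦ q.eval x.2 := q.continuous.comp continuous_snd
    have hr : Continuous fun x : ℝ × ℂ ↦ r.eval x.2 := r.continuous.comp continuous_snd
    fun_prop
  set S : Set unitInterval := {ε | ∃ t : ℂ, 0 < t.im ∧ F ε t = 0} with hS
  have hopen : IsOpen S := by
    rw [isOpen_iff_mem_nhds]
    rintro ε₀ ⟨t₀, ht₀, hz⟩
    have hcont : Continuous fun ε : unitInterval ↦ ‖F ε t₀‖ :=
      (hFc.comp (continuous_subtype_val.prodMk continuous_const)).norm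
    have hev : ∀ᶠ ε : unitInterval in nhds ε₀, ‖F ε t₀‖ < l * t₀.im ^ n :=
      hcont.continuousAt.eventually_lt continuousAt_const (by rw [hz, norm_zero]; positivity)
    filter_upwards [hev] with ε hε
    obtain ⟨ρ, hρ, hρt⟩ := exists_isRoot_near (p := q + C ((ε : ℝ) : ℂ) * r) (z := t₀) ht₀ (by
      rw [hFe, hdeg ε ε.2]
      exact hε.trans_le (by gcongr; exact hlead ε ε.2))
    refine ⟨ρ, ?_, by rw [← hFe]; exact hρ⟩
    have := (Complex.abs_im_le_norm (ρ - t₀)).trans_lt hρt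
    rw [Complex.sub_im, abs_lt] at this
    linarith
  have hclosed : IsClosed S := by
    -- Cauchy's bound confines the zeros for all `ε` to one compact disc.
    set K : ℝ := ∑ i ∈ Finset.range n, (‖q.coeff i‖ + ‖r.coeff i‖) with hK
    have hbound : ∀ (ε : unitInterval) (t : ℂ), F ε t = 0 → ‖t‖ ≤ K / l + 1 := by
      intro ε t hz
      set p := q + C ((ε : ℝ) : ℂ) * r with hp
      have hlp := hlead ε ε.2
      have hp0 : p ≠ 0 := fun h ↦ by rw [← hp, h] at hlp; simp at hlp; linarith
      have hroot : p.IsRoot t := by rw [IsRoot, hFe, hz]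
      have hlt : ‖t‖ < p.cauchyBound := hroot.norm_lt_cauchyBound hp0
      refine hlt.le.trans ?_
      rw [cauchyBound, hdeg ε ε.2]
      push_cast
      gcongr
      · have : (Finset.range n).sup (fun i ↦ ‖p.coeff i‖₊) ≤
            ∑ i ∈ Finset.range n, (‖q.coeff i‖₊ + ‖r.coeff i‖₊) := by
          refine Finset.sup_le fun i hi ↦ le_trans ?_
            (Finset.single_le_sum (f := fun i ↦ ‖q.coeff i‖₊ + ‖r.coeff i‖₊)
              (fun _ _ ↦ zero_le) hi)
          rw [hp, coeff_add, coeff_C_mul]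
          refine (nnnorm_add_le _ _).trans ?_
          gcongr
          rw [nnnorm_mul]
          refine mul_le_of_le_one_left (zero_le) ?_
          rw [← NNReal.coe_le_coe, coe_nnnorm, Complex.norm_real, Real.norm_eq_abs,
            abs_of_nonneg ε.2.1]
          exact ε.2.2
        rw [hK]
        have h' := NNReal.coe_le_coe.mpr this
        push_cast at h'
        exact h'
    have himage : S = Prod.fst '' {x : unitInterval × ℂ |
        x.2 ∈ Metric.closedBall 0 (K / l + 1) ∧ 0 ≤ x.2.im ∧ F x.1 x.2 = 0} := by
      ext ε
      constructor
      · rintro ⟨t, ht, hz⟩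
        exact ⟨(ε, t), ⟨by simpa using hbound ε t hz, ht.le, hz⟩, rfl⟩
      · rintro ⟨⟨ε', t⟩, ⟨-, ht, hz⟩, rfl⟩
        refine ⟨t, lt_of_le_of_ne ht fun him ↦ ?_, hz⟩
        have htre : t = (t.re : ℂ) := Complex.ext (by simp) (by simp [← him])
        refine hreal ε' ε'.2 t.re ?_
        rw [hFe, ← htre]
        exact hz
    rw [himage]
    refine (IsCompact.image (IsCompact.of_isClosed_subset
      (isCompact_univ.prod (isCompact_closedBall (0 : ℂ) (K / l + 1))) ?_ ?_)
      continuous_fst).isClosed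
    · have hc2 : Continuous fun x : unitInterval × ℂ ↦ F x.1 x.2 :=
        hFc.comp ((continuous_subtype_val.comp continuous_fst).prodMk continuous_snd)
      exact (Metric.isClosed_closedBall.preimage continuous_snd).inter
        ((isClosed_le continuous_const (Complex.continuous_im.comp continuous_snd)).inter
          (isClosed_eq hc2 continuous_const))
    · rintro ⟨ε, t⟩ ⟨h, -⟩
      exact ⟨Set.mem_univ _, h⟩
  intro hz
  have h1 : (1 : unitInterval) ∈ S := ⟨t, ht, by simpa [hF] using hz⟩
  have huniv : S = Set.univ := IsClopen.eq_univ ⟨hclosed, hopen⟩ ⟨_, h1⟩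
  obtain ⟨t', ht', hz'⟩ : (0 : unitInterval) ∈ S := huniv ▸ Set.mem_univ _
  exact h0 t' ht' (by simpa [hF] using hz')

/-! ### The diagonal polynomial on lines -/

/-- A real quadratic with nonnegative discriminant and a nonreal zero is constant. -/
theorem eq_zero_of_quadratic_of_discrim_nonneg {A B C : ℝ} {s : ℂ} (hs : 0 < s.im)
    (h : (A : ℂ) * s ^ 2 + B * s + C = 0) (hD : 0 ≤ B ^ 2 - 4 * A * C) : A = 0 ∧ B = 0 := by
  have him := congrArg Complex.im h
  have hre := congrArg Complex.re h
  simp only [pow_two, Complex.add_im, Complex.mul_im, Complex.mul_re, Complex.add_re,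
    Complex.ofReal_re, Complex.ofReal_im, Complex.zero_im, Complex.zero_re] at him hre
  have him' : 2 * A * s.re + B = 0 := by
    have : s.im * (2 * A * s.re + B) = 0 := by linear_combination him
    exact (mul_eq_zero.mp this).resolve_left hs.ne'
  -- The discriminant equals `-(2 A Im s)²`.
  have hsq : 4 * (A * s.im) ^ 2 = -(B ^ 2 - 4 * A * C) := by
    linear_combination (-4 * A) * hre + (2 * A * s.re + B) * him'
  have hA : A = 0 := by
    have h0 : A * s.im = 0 := pow_eq_zero_iff two_ne_zero |>.mp
      (le_antisymm (by linarith) (sq_nonneg _))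
    exact (mul_eq_zero.mp h0).resolve_right hs.ne'
  refine ⟨hA, ?_⟩
  rw [hA] at him'
  linarith

/-- The polynomial `4 e₁ e₃` in five variables. -/
def diagPoly {R : Type*} [CommSemiring R] (s a b c d : R) : R :=
  4 * ((s + a + b + c + d) * (s * (a * b + a * c + a * d + b * c + b * d + c * d) +
    (a * b * c + a * b * d + a * c * d + b * c * d)))

/-- The sum of `zᵢ² zⱼ²` over the edges `ac`, `ad`, `bd` of a path, which correspond to the three
unions of two pairs that are bases of `V₁₀`. With both variables of each pair set equal, `f₁₀`
becomes `diagPoly s a b c d + pathPoly a b c d`. -/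
def pathPoly {R : Type*} [CommSemiring R] (a b c d : R) : R :=
  a ^ 2 * c ^ 2 + a ^ 2 * d ^ 2 + b ^ 2 * d ^ 2

/-- For real `a, b, c, d`, at most one of them zero, all zeros `s` of the deformed polynomial are
real. If three of the coordinates vanish, then so does the polynomial, identically in `s`. -/
theorem diagPoly_add_ne_zero_of_real {s : ℂ} (hs : 0 < s.im) {a b c d ε : ℝ}
    (hε : ε ∈ Set.Icc (0 : ℝ) 1)
    (hab : a ≠ 0 ∨ b ≠ 0) (hac : a ≠ 0 ∨ c ≠ 0) (had : a ≠ 0 ∨ d ≠ 0)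
    (hbc : b ≠ 0 ∨ c ≠ 0) (hbd : b ≠ 0 ∨ d ≠ 0) (hcd : c ≠ 0 ∨ d ≠ 0) :
    diagPoly s (a : ℂ) b c d + ε * pathPoly (a : ℂ) b c d ≠ 0 := by
  intro h
  have hdisc := disc_nonneg a b c d
  set E₁ := a + b + c + d with hE₁
  set E₂ := a * b + a * c + a * d + b * c + b * d + c * d with hE₂
  set E₃ := a * b * c + a * b * d + a * c * d + b * c * d with hE₃
  set N := a ^ 2 * c ^ 2 + a ^ 2 * d ^ 2 + b ^ 2 * d ^ 2 with hN
  have hquad : 4 * (E₂ : ℂ) * s ^ 2 + 4 * (E₁ * E₂ + E₃) * s + (4 * E₁ * E₃ + ε * N) = 0 := by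
    rw [← h, diagPoly, pathPoly, hE₁, hE₂, hE₃, hN]; push_cast; ring
  have hN0 : 0 ≤ N := by positivity
  have hD : ε * (E₂ * N) ≤ (E₁ * E₂ - E₃) ^ 2 := by
    rcases le_total (E₂ * N) 0 with hneg | hpos
    · exact (mul_nonpos_of_nonneg_of_nonpos hε.1 hneg).trans (sq_nonneg _)
    · exact (mul_le_of_le_one_left hpos hε.2).trans hdisc
  obtain ⟨h4E₂, hB⟩ := eq_zero_of_quadratic_of_discrim_nonneg (A := 4 * E₂)
    (B := 4 * (E₁ * E₂ + E₃)) (C := 4 * E₁ * E₃ + ε * N) hs (by push_cast; exact hquad)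
    (by linear_combination 16 * hD)
  have hE₂0 : E₂ = 0 := by linarith
  have hE₃0 : E₃ = 0 := by rw [hE₂0] at hB; linarith
  -- With `e₂ = e₃ = 0`, the four triple products have sum of squares `e₃² - 2 e₂ e₄ = 0`.
  have hsum : (a * b * c) ^ 2 + (a * b * d) ^ 2 + (a * c * d) ^ 2 + (b * c * d) ^ 2 = 0 := by
    linear_combination E₃ * hE₃0 - 2 * (a * b * c * d) * hE₂0
  have h1 : a * b * c = 0 := pow_eq_zero_iff two_ne_zero |>.mp (le_antisymm
    (by linarith [sq_nonneg (a * b * d), sq_nonneg (a * c * d), sq_nonneg (b * c * d)])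
    (sq_nonneg _))
  have h2 : a * b * d = 0 := pow_eq_zero_iff two_ne_zero |>.mp (le_antisymm
    (by linarith [sq_nonneg (a * b * c), sq_nonneg (a * c * d), sq_nonneg (b * c * d)])
    (sq_nonneg _))
  have h3 : a * c * d = 0 := pow_eq_zero_iff two_ne_zero |>.mp (le_antisymm
    (by linarith [sq_nonneg (a * b * c), sq_nonneg (a * b * d), sq_nonneg (b * c * d)])
    (sq_nonneg _))
  have h4 : b * c * d = 0 := pow_eq_zero_iff two_ne_zero |>.mp (le_antisymm
    (by linarith [sq_nonneg (a * b * c), sq_nonneg (a * b * d), sq_nonneg (a * c * d)])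
    (sq_nonneg _))
  by_cases ha : a = 0
  · have hb := hab.resolve_left (not_not.mpr ha)
    have hc := hac.resolve_left (not_not.mpr ha)
    have hd := had.resolve_left (not_not.mpr ha)
    exact mul_ne_zero (mul_ne_zero hb hc) hd h4
  by_cases hb : b = 0
  · have hc := hbc.resolve_left (not_not.mpr hb)
    have hd := hbd.resolve_left (not_not.mpr hb)
    exact mul_ne_zero (mul_ne_zero ha hc) hd h3
  rcases hcd with hc | hd
  · exact mul_ne_zero (mul_ne_zero ha hb) hc h1
  · exact mul_ne_zero (mul_ne_zero ha hb) hd h2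

open Polynomial in
/-- The restriction of `diagPoly s` to the line `x + t y`, as a polynomial in `t`. -/
noncomputable def diagLine (s : ℂ) (x y : Fin 4 → ℝ) : ℂ[X] :=
  diagPoly (C s) (C (x 0 : ℂ) + C (y 0 : ℂ) * X) (C (x 1 : ℂ) + C (y 1 : ℂ) * X)
    (C (x 2 : ℂ) + C (y 2 : ℂ) * X) (C (x 3 : ℂ) + C (y 3 : ℂ) * X)

open Polynomial in
/-- The restriction of `pathPoly` to the line `x + t y`, as a polynomial in `t`. -/
noncomputable def pathLine (x y : Fin 4 → ℝ) : ℂ[X] :=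
  pathPoly (C (x 0 : ℂ) + C (y 0 : ℂ) * X) (C (x 1 : ℂ) + C (y 1 : ℂ) * X)
    (C (x 2 : ℂ) + C (y 2 : ℂ) * X) (C (x 3 : ℂ) + C (y 3 : ℂ) * X)

open Polynomial in
theorem eval_diagLine_add (s : ℂ) (x y : Fin 4 → ℝ) (ε t : ℂ) :
    (diagLine s x y + C ε * pathLine x y).eval t =
      diagPoly s (x 0 + y 0 * t) (x 1 + y 1 * t) (x 2 + y 2 * t) (x 3 + y 3 * t) +
      ε * pathPoly (x 0 + y 0 * t) (x 1 + y 1 * t) (x 2 + y 2 * t) (x 3 + y 3 * t) := by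
  simp [diagLine, pathLine, diagPoly, pathPoly]

open Polynomial in
theorem diagLine_add_natDegree_leadingCoeff (s : ℂ) (x : Fin 4 → ℝ) {y : Fin 4 → ℝ}
    (hy : ∀ i, 0 < y i) {ε : ℝ} (hε : 0 ≤ ε) :
    (diagLine s x y + C (ε : ℂ) * pathLine x y).natDegree = 4 ∧
    diagPoly 0 (y 0) (y 1) (y 2) (y 3) ≤
      ‖(diagLine s x y + C (ε : ℂ) * pathLine x y).leadingCoeff‖ ∧
    0 < diagPoly 0 (y 0) (y 1) (y 2) (y 3) := by
  set P := diagLine s x y + C (ε : ℂ) * pathLine x y with hP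
  have hle : P.natDegree ≤ 4 := by
    rw [hP, diagLine, pathLine, diagPoly, pathPoly]
    compute_degree
  have hcoeff : P.coeff 4 = ((diagPoly 0 (y 0) (y 1) (y 2) (y 3) +
      ε * pathPoly (y 0) (y 1) (y 2) (y 3) : ℝ) : ℂ) := by
    rw [hP, diagLine, pathLine]
    simp only [diagPoly, pathPoly]
    push_cast
    compute_degree!
  have h0 := hy 0
  have h1 := hy 1
  have h2 := hy 2
  have h3 := hy 3
  have hpos : 0 < diagPoly 0 (y 0) (y 1) (y 2) (y 3) := by
    rw [diagPoly, zero_mul, zero_add, zero_add]; positivity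
  have hpath : 0 ≤ ε * pathPoly (y 0) (y 1) (y 2) (y 3) := by rw [pathPoly]; positivity
  have hdeg : P.natDegree = 4 := by
    refine natDegree_eq_of_le_of_coeff_ne_zero hle ?_
    rw [hcoeff]
    exact Complex.ofReal_ne_zero.mpr (by linarith)
  refine ⟨hdeg, ?_, hpos⟩
  rw [leadingCoeff, hdeg, hcoeff, Complex.norm_real, Real.norm_eq_abs]
  exact (by linarith : _ ≤ _).trans (le_abs_self _)

open Polynomial in
/-- Nonvanishing in the upper half-plane on lines `x + t y` no point of which has two zero
coordinates, by deforming `4 e₁ e₃` into the polynomial at hand. -/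
theorem eval_line_ne_zero_of_pairwise {s : ℂ} (hs : 0 < s.im) {x y : Fin 4 → ℝ}
    (hy : ∀ i, 0 < y i) (hxy : ∀ i j, i < j → x i * y j ≠ x j * y i) {t : ℂ} (ht : 0 < t.im) :
    (diagLine s x y + pathLine x y).eval t ≠ 0 := by
  refine eval_add_ne_zero_of_segment
    (diagLine_add_natDegree_leadingCoeff s x hy le_rfl).2.2
    (fun ε hε ↦ (diagLine_add_natDegree_leadingCoeff s x hy hε.1).1)
    (fun ε hε ↦ (diagLine_add_natDegree_leadingCoeff s x hy hε.1).2.1)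
    (fun ε hε τ ↦ ?_) (fun τ hτ ↦ ?_) ht
  · have hor : ∀ i j, i < j → x i + y i * τ ≠ 0 ∨ x j + y j * τ ≠ 0 := by
      intro i j hij
      by_contra! h
      exact hxy i j hij (by linear_combination y j * h.1 - y i * h.2)
    rw [eval_diagLine_add]
    have := diagPoly_add_ne_zero_of_real hs hε (hor 0 1 (by decide)) (hor 0 2 (by decide))
      (hor 0 3 (by decide)) (hor 1 2 (by decide)) (hor 1 3 (by decide)) (hor 2 3 (by decide))
    push_cast at this
    exact this
  · have hpos : ∀ i, 0 < ((x i : ℂ) + y i * τ).im := by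
      intro i
      rw [Complex.add_im, Complex.ofReal_im, Complex.im_ofReal_mul, zero_add]
      exact mul_pos (hy i) hτ
    have h := eval_diagLine_add s x y 0 τ
    rw [C_0, zero_mul, add_zero, zero_mul, add_zero] at h
    rw [h, diagPoly]
    refine mul_ne_zero four_ne_zero (mul_ne_zero (fun h0 ↦ ?_)
      (esymm_three_ne_zero hs (hpos 0) (hpos 1) (hpos 2) (hpos 3)))
    have him := congrArg Complex.im h0
    simp only [Complex.add_im, Complex.zero_im] at him
    have h0 := hpos 0
    have h1 := hpos 1
    have h2 := hpos 2
    have h3 := hpos 3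
    simp only [Complex.add_im] at h0 h1 h2 h3
    linarith

open Polynomial in
/-- Nonvanishing on all lines with positive direction. A zero in the upper half-plane would
persist on nearby lines, and almost all of those satisfy the condition of
`eval_line_ne_zero_of_pairwise`. -/
theorem eval_line_ne_zero {s : ℂ} (hs : 0 < s.im) {x y : Fin 4 → ℝ}
    (hy : ∀ i, 0 < y i) {t : ℂ} (ht : 0 < t.im) :
    (diagLine s x y + pathLine x y).eval t ≠ 0 := by
  intro hz
  -- Translating `x i` by `η * i * y i` makes the zeros of the four coordinates distinct.
  set x' : ℝ → Fin 4 → ℝ := fun η i ↦ x i + η * (i : ℕ) * y i with hx'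
  have hgen : ∀ᶠ η in nhdsWithin (0 : ℝ) {0}ᶜ,
      ∀ i j, i < j → x' η i * y j ≠ x' η j * y i := by
    refine Filter.eventually_all.mpr fun i ↦ Filter.eventually_all.mpr fun j ↦ ?_
    by_cases hij : i < j
    · have hfin : {η : ℝ | x' η i * y j = x' η j * y i}.Finite := by
        refine Set.Subsingleton.finite fun η hη η' hη' ↦ ?_
        simp only [hx', Set.mem_ofPred_eq] at hη hη'
        have hne : ((i : ℕ) : ℝ) - (j : ℕ) ≠ 0 := sub_ne_zero.mpr (by
          exact_mod_cast (Fin.lt_def.mp hij).ne)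
        have hyy : y i * y j ≠ 0 := (mul_pos (hy i) (hy j)).ne'
        apply mul_right_cancel₀ (mul_ne_zero hne hyy)
        linear_combination hη - hη'
      filter_upwards [nhdsNE_le_cofinite 0 hfin.compl_mem_cofinite] with η hη _
      exact hη
    · exact Filter.Eventually.of_forall fun _ h ↦ absurd h hij
  set l := diagPoly 0 (y 0) (y 1) (y 2) (y 3) with hl
  have hlpos : 0 < l := (diagLine_add_natDegree_leadingCoeff s x hy le_rfl).2.2
  have hcont : Continuous fun η : ℝ ↦ ‖(diagLine s (x' η) y + C ((1 : ℝ) : ℂ) *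
      pathLine (x' η) y).eval t‖ := by
    simp only [eval_diagLine_add, diagPoly, pathPoly, hx']
    push_cast
    fun_prop
  have hsmall : ∀ᶠ η in nhdsWithin (0 : ℝ) {0}ᶜ, ‖(diagLine s (x' η) y + C ((1 : ℝ) : ℂ) *
      pathLine (x' η) y).eval t‖ < l * t.im ^ 4 := by
    refine (hcont.continuousAt.eventually_lt continuousAt_const ?_).filter_mono
      nhdsWithin_le_nhds
    have : x' 0 = x := by funext i; simp [hx']
    rw [this, Complex.ofReal_one, C_1, one_mul, hz, norm_zero]
    positivity
  obtain ⟨η, hη, hηs⟩ := (hgen.and hsmall).exists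
  obtain ⟨hdeg, hlead, -⟩ := diagLine_add_natDegree_leadingCoeff s (x' η) hy zero_le_one
  obtain ⟨ρ, hρ, hρt⟩ := exists_isRoot_near ht (hηs.trans_le (by rw [hdeg]; gcongr))
  rw [Complex.ofReal_one, C_1, one_mul] at hρ
  refine eval_line_ne_zero_of_pairwise hs hy hη ?_ hρ
  have := (Complex.abs_im_le_norm (ρ - t)).trans_lt hρt
  rw [Complex.sub_im, abs_lt] at this
  linarith

theorem diagPoly_add_pathPoly_ne_zero {s a b c d : ℂ} (hs : 0 < s.im) (ha : 0 < a.im)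
    (hb : 0 < b.im) (hc : 0 < c.im) (hd : 0 < d.im) :
    diagPoly s a b c d + pathPoly a b c d ≠ 0 := by
  have h := eval_line_ne_zero hs (x := ![a.re, b.re, c.re, d.re])
    (y := ![a.im, b.im, c.im, d.im]) (by simp [Fin.forall_fin_succ, ha, hb, hc, hd])
    (t := Complex.I) (by simp)
  have he := eval_diagLine_add s ![a.re, b.re, c.re, d.re] ![a.im, b.im, c.im, d.im] 1 Complex.I
  rw [Polynomial.C_1, one_mul, one_mul] at he
  rw [he] at h
  simpa [Complex.re_add_im] using h

/-! ### Stability -/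

/-- `f₁₀` has no zeros in the tenth power of the upper half-plane: the Grace–Walsh–Szegő theorem
replaces the two variables of each pair by a single one. -/
theorem pairPoly_ne_zero {x : Fin 10 → ℂ} (hx : ∀ i, 0 < (x i).im) :
    pairPoly (x 0 + x 1) (x 2 + x 3) (x 4 + x 5) (x 6 + x 7) (x 8 + x 9)
      (x 0 * x 1) (x 2 * x 3) (x 4 * x 5) (x 6 * x 7) (x 8 * x 9) ≠ 0 := by
  intro h
  -- A function affine in `(σ, π)` is determined by three values.
  have affine : ∀ {f : ℂ → ℂ → ℂ} {u v : ℂ}, 0 < u.im → 0 < v.im →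
      (∀ σ π, f σ π = (f 0 1 - f 0 0) * π + (f 1 0 - f 0 0) * σ + f 0 0) →
      f (u + v) (u * v) = 0 → ∃ z : ℂ, 0 < z.im ∧ f (2 * z) (z ^ 2) = 0 := by
    intro f u v hu hv hf h0
    rw [hf] at h0
    obtain ⟨z, hz, hz0⟩ := exists_quadratic_root_of_polarization hu hv h0
    exact ⟨z, hz, by rw [hf]; exact hz0⟩
  obtain ⟨z₁, hz₁, h⟩ := affine (f := fun σ π ↦ pairPoly σ _ _ _ _ π _ _ _ _) (hx 0) (hx 1)
    (fun σ π ↦ by simp only [pairPoly]; ring) h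
  obtain ⟨z₂, hz₂, h⟩ := affine (f := fun σ π ↦ pairPoly _ σ _ _ _ _ π _ _ _) (hx 2) (hx 3)
    (fun σ π ↦ by simp only [pairPoly]; ring) h
  obtain ⟨z₃, hz₃, h⟩ := affine (f := fun σ π ↦ pairPoly _ _ σ _ _ _ _ π _ _) (hx 4) (hx 5)
    (fun σ π ↦ by simp only [pairPoly]; ring) h
  obtain ⟨z₄, hz₄, h⟩ := affine (f := fun σ π ↦ pairPoly _ _ _ σ _ _ _ _ π _) (hx 6) (hx 7)
    (fun σ π ↦ by simp only [pairPoly]; ring) h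
  obtain ⟨z₅, hz₅, h⟩ := affine (f := fun σ π ↦ pairPoly _ _ _ _ σ _ _ _ _ π) (hx 8) (hx 9)
    (fun σ π ↦ by simp only [pairPoly]; ring) h
  refine diagPoly_add_pathPoly_ne_zero hz₁ hz₂ hz₃ hz₄ hz₅ ?_
  rw [← h, diagPoly, pathPoly, pairPoly]
  ring

theorem aeval_vamosTenPoly {R : Type*} [CommRing R] [Algebra ℝ R] (x : Fin 10 → R) :
    MvPolynomial.aeval x vamosTenPoly =
      pairPoly (x 0 + x 1) (x 2 + x 3) (x 4 + x 5) (x 6 + x 7) (x 8 + x 9)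
        (x 0 * x 1) (x 2 * x 3) (x 4 * x 5) (x 6 * x 7) (x 8 * x 9) := by
  rw [← sum_vamosTenBases_prod, vamosTenPoly, map_sum]
  simp only [map_prod, MvPolynomial.aeval_X]

theorem MvPolynomial.isStable_of_aeval_ne_zero {α : Type*} {f : MvPolynomial α ℝ}
    (h : ∀ x : α → ℂ, (∀ i, 0 < (x i).im) → MvPolynomial.aeval x f ≠ 0) : f.IsStable := by
  intro v w hv
  have hupper : ∀ z : ℂ, 0 < z.im → Polynomial.aeval z (f.restrictToLine v w) ≠ 0 := by
    intro z hz
    rw [MvPolynomial.restrictToLine, ← AlgHom.comp_apply, MvPolynomial.comp_aeval]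
    refine h _ fun i ↦ ?_
    simpa using mul_pos (hv i) hz
  intro z hz
  rcases lt_trichotomy z.im 0 with hneg | h0 | hpos
  · refine absurd ?_ (hupper (starRingEnd ℂ z) (by simpa using hneg))
    rw [Polynomial.aeval_conj, hz, map_zero]
  · exact h0
  · exact absurd hz (hupper z hpos)

theorem vamosTenPoly_isStable : vamosTenPoly.IsStable :=
  MvPolynomial.isStable_of_aeval_ne_zero fun x hx ↦ by
    rw [aeval_vamosTenPoly]
    exact pairPoly_ne_zero hx

/-! ### Determinantal representations -/

/-- The Vámos configuration is not realizable by subspaces; this is the dual form, in terms of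
intersections. The dimensions force `C = (A ⊓ C) ⊔ (B ⊓ C) ≤ A ⊔ B` and likewise `D ≤ A ⊔ B`, but
`C ⊕ D` has dimension `4k` and `A ⊔ B` only `3k`. -/
theorem Submodule.no_dual_vamos_configuration {K V : Type*} [DivisionRing K] [AddCommGroup V]
    [Module K V] [FiniteDimensional K V] {A B C D : Submodule K V} {k : ℕ} (hk : 1 ≤ k)
    (hA : Module.finrank K A = 2 * k) (hB : Module.finrank K B = 2 * k)
    (hC : Module.finrank K C = 2 * k) (hD : Module.finrank K D = 2 * k)
    (hAB : Module.finrank K ↥(A ⊓ B) = k)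
    (hAC : Module.finrank K ↥(A ⊓ C) = k) (hBC : Module.finrank K ↥(B ⊓ C) = k)
    (hAD : Module.finrank K ↥(A ⊓ D) = k) (hBD : Module.finrank K ↥(B ⊓ D) = k)
    (hABC : A ⊓ B ⊓ C = ⊥) (hABD : A ⊓ B ⊓ D = ⊥) (hCD : C ⊓ D = ⊥) : False := by
  have key : ∀ E : Submodule K V, Module.finrank K E = 2 * k →
      Module.finrank K ↥(A ⊓ E) = k → Module.finrank K ↥(B ⊓ E) = k → A ⊓ B ⊓ E = ⊥ →
      E ≤ A ⊔ B := by
    intro E hE hAE hBE hABE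
    have h0 : A ⊓ E ⊓ (B ⊓ E) = ⊥ := by rw [← inf_inf_distrib_right, hABE]
    have h1 := Submodule.finrank_sup_add_finrank_inf_eq (A ⊓ E) (B ⊓ E)
    rw [h0, finrank_bot, hAE, hBE] at h1
    have h2 : A ⊓ E ⊔ B ⊓ E = E :=
      Submodule.eq_of_le_of_finrank_le (sup_le inf_le_right inf_le_right) (by omega)
    rw [← h2]
    exact sup_le_sup inf_le_left inf_le_left
  have h1 : C ⊔ D ≤ A ⊔ B := sup_le (key C hC hAC hBC hABC) (key D hD hAD hBD hABD)
  have h2 := Submodule.finrank_mono h1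
  have h3 := Submodule.finrank_sup_add_finrank_inf_eq A B
  have h4 := Submodule.finrank_sup_add_finrank_inf_eq C D
  rw [hCD, finrank_bot] at h4
  omega

theorem Matrix.PosSemidef.ker_mulVecLin_add {n : Type*} [Fintype n] {A B : Matrix n n ℂ}
    (hA : A.PosSemidef) (hB : B.PosSemidef) :
    LinearMap.ker (A + B).mulVecLin = LinearMap.ker A.mulVecLin ⊓ LinearMap.ker B.mulVecLin := by
  ext v
  simp only [Submodule.mem_inf, LinearMap.mem_ker, Matrix.mulVecLin_apply]
  refine ⟨fun h ↦ ?_, fun h ↦ by rw [Matrix.add_mulVec, h.1, h.2, add_zero]⟩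
  have hsum : star v ⬝ᵥ A.mulVec v + star v ⬝ᵥ B.mulVec v = 0 := by
    rw [← dotProduct_add, ← Matrix.add_mulVec, h, dotProduct_zero]
  rw [← hA.dotProduct_mulVec_zero_iff, ← hB.dotProduct_mulVec_zero_iff]
  exact (add_eq_zero_iff_of_nonneg (hA.dotProduct_mulVec_nonneg v)
    (hB.dotProduct_mulVec_nonneg v)).mp hsum

/-- The kernel of a Hermitian matrix has the dimension of the multiplicity of `0` in the
characteristic polynomial. -/
theorem Matrix.IsHermitian.finrank_ker_mulVecLin {n : Type*} [Fintype n] [DecidableEq n]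
    {P : Matrix n n ℂ} (hP : P.IsHermitian) {m : ℕ} {Q : Polynomial ℂ}
    (h : P.charpoly = Polynomial.X ^ m * Q) (hQ : Q.eval 0 ≠ 0) :
    Module.finrank ℂ (LinearMap.ker P.mulVecLin) = m := by
  have hroots : P.charpoly.roots.count 0 = m := by
    have h0 : P.charpoly ≠ 0 := P.charpoly_monic.ne_zero
    rw [h] at h0 ⊢
    rw [Polynomial.roots_mul h0, Multiset.count_add, Polynomial.roots_X_pow,
      Multiset.count_nsmul, Multiset.count_singleton_self, Polynomial.count_roots,
      Polynomial.rootMultiplicity_eq_zero hQ, mul_one, add_zero]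
  have hcount : Fintype.card {i // hP.eigenvalues i = 0} = m := by
    rw [← hroots, hP.roots_charpoly_eq_eigenvalues, Multiset.count_map, Fintype.card_subtype]
    rw [Finset.card_def, Finset.filter_val]
    congr 2
    ext i
    simp only [Function.comp_apply, eq_comm (a := (0 : ℂ))]
    exact RCLike.ofReal_eq_zero.symm
  have h1 := LinearMap.finrank_range_add_finrank_ker P.mulVecLin
  have h2 := hP.rank_eq_card_non_zero_eigs
  rw [Matrix.rank] at h2
  have h3 := Fintype.card_subtype_compl fun i ↦ hP.eigenvalues i = 0
  have h4 := Fintype.card_subtype_le fun i ↦ hP.eigenvalues i = 0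
  rw [Module.finrank_fintype_fun_eq_card] at h1
  simp only [ne_eq] at h2
  omega

theorem Matrix.PosSemidef.ker_mulVecLin_sum_union {ι n : Type*} [Fintype n] [DecidableEq ι]
    {A : ι → Matrix n n ℂ} (hA : ∀ i, (A i).PosSemidef) {S T : Finset ι} (hST : Disjoint S T) :
    LinearMap.ker (∑ i ∈ S ∪ T, A i).mulVecLin =
      LinearMap.ker (∑ i ∈ S, A i).mulVecLin ⊓ LinearMap.ker (∑ i ∈ T, A i).mulVecLin := by
  rw [Finset.sum_union hST]
  exact (Matrix.posSemidef_sum S fun i _ ↦ hA i).ker_mulVecLin_add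
    (Matrix.posSemidef_sum T fun i _ ↦ hA i)

/-- If positive semidefinite matrices with sum `1` represent `c F ^ k`, then the kernel of
`∑ i ∈ S, A i` has dimension `k` times the order of vanishing at `t = 0` of `F (t • 1 - 1_S)`. -/
theorem finrank_ker_of_det_eq_pow {ι n : Type*} [Fintype ι] [DecidableEq ι] [Fintype n]
    [DecidableEq n] {A : ι → Matrix n n ℂ} (hA : ∀ i, (A i).PosSemidef) (hsum : ∑ i, A i = 1)
    {F : (ι → ℂ) → ℂ} {c : ℂ} (hc : c ≠ 0) {k : ℕ}
    (hdet : ∀ x : ι → ℂ, (∑ i, x i • A i).det = c * F x ^ k)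
    {S : Finset ι} {m : ℕ} {Q : Polynomial ℂ}
    (hF : ∀ t : ℂ, F (fun i ↦ if i ∈ S then t - 1 else t) = t ^ m * Q.eval t)
    (hQ : Q.eval 0 ≠ 0) :
    Module.finrank ℂ (LinearMap.ker (∑ i ∈ S, A i).mulVecLin) = m * k := by
  refine (Matrix.posSemidef_sum S fun i _ ↦ hA i).isHermitian.finrank_ker_mulVecLin
    (Q := Polynomial.C c * Q ^ k) (Polynomial.funext fun t ↦ ?_) (by simp [hc, hQ])
  have hpencil : Matrix.scalar n t - ∑ i ∈ S, A i =
      ∑ i, (if i ∈ S then t - 1 else t) • A i := by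
    have h1 : Matrix.scalar n t = ∑ i, t • A i := by
      rw [← Finset.smul_sum, hsum, Matrix.smul_one_eq_diagonal]; rfl
    have h2 : ∑ i ∈ S, A i = ∑ i, if i ∈ S then A i else 0 := by
      rw [Finset.sum_ite_mem, Finset.univ_inter]
    rw [h1, h2, ← Finset.sum_sub_distrib]
    refine Finset.sum_congr rfl fun i _ ↦ ?_
    split_ifs
    · rw [sub_smul, one_smul]
    · rw [sub_zero]
  rw [Matrix.eval_charpoly, hpencil, hdet, hF]
  simp only [Polynomial.eval_mul, Polynomial.eval_pow, Polynomial.eval_X, Polynomial.eval_C]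
  ring

/-- By congruence, a definite determinantal representation can be normalized to have sum `1`; the
determinant only changes by a constant factor. -/
theorem exists_normalized_det_rep {ι n : Type*} [Fintype ι] [Fintype n] [DecidableEq n]
    {A : ι → Matrix n n ℂ} (hA : ∀ i, (A i).PosSemidef) (hdet : (∑ i, A i).det ≠ 0) :
    ∃ A' : ι → Matrix n n ℂ, (∀ i, (A' i).PosSemidef) ∧ ∑ i, A' i = 1 ∧
      ∃ c : ℂ, c ≠ 0 ∧ ∀ x : ι → ℂ, (∑ i, x i • A' i).det = c * (∑ i, x i • A i).det := by
  obtain ⟨B, hB⟩ : ∃ B : Matrix n n ℂ, ∑ i, A i = B.conjTranspose * B := by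
    open scoped MatrixOrder in
    exact CStarAlgebra.nonneg_iff_eq_star_mul_self.mp
      (Matrix.posSemidef_sum Finset.univ fun i _ ↦ hA i).nonneg
  have hBu : IsUnit B.det := by
    rw [hB, Matrix.det_mul] at hdet
    exact isUnit_iff_ne_zero.mpr (right_ne_zero_of_mul hdet)
  refine ⟨fun i ↦ (B⁻¹).conjTranspose * A i * B⁻¹,
    fun i ↦ (hA i).conjTranspose_mul_mul_same B⁻¹, ?_,
    (B⁻¹).conjTranspose.det * (B⁻¹).det, ?_, fun x ↦ ?_⟩
  · rw [← Finset.sum_mul, ← Finset.mul_sum, hB, ← mul_assoc, ← Matrix.conjTranspose_mul,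
      Matrix.mul_nonsing_inv B hBu, Matrix.conjTranspose_one, one_mul,
      Matrix.mul_nonsing_inv B hBu]
  · have h : (B⁻¹).det ≠ 0 := (Matrix.isUnit_nonsing_inv_det B hBu).ne_zero
    rw [Matrix.det_conjTranspose]
    exact mul_ne_zero (star_ne_zero.mpr h) h
  · have : ∑ i, x i • ((B⁻¹).conjTranspose * A i * B⁻¹) =
        (B⁻¹).conjTranspose * (∑ i, x i • A i) * B⁻¹ := by
      rw [Finset.mul_sum, Finset.sum_mul]
      simp only [Matrix.mul_smul, Matrix.smul_mul]
    rw [this, Matrix.det_mul, Matrix.det_mul]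
    ring

open Polynomial in
/-- No power of the diagonal polynomial has a normalized definite determinantal representation: the
kernels attached to its variables `0, 2, 1, 3` would form a dual Vámos configuration. -/
theorem not_exists_normalized_pencil {n : Type*} [Fintype n] [DecidableEq n] {k : ℕ}
    (hk : 1 ≤ k) {A : Fin 5 → Matrix n n ℂ} (hA : ∀ i, (A i).PosSemidef) (hsum : ∑ i, A i = 1)
    {c : ℂ} (hc : c ≠ 0) (hdet : ∀ z : Fin 5 → ℂ, (∑ i, z i • A i).det =
      c * (diagPoly (z 0) (z 1) (z 2) (z 3) (z 4) + pathPoly (z 1) (z 2) (z 3) (z 4)) ^ k) :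
    False := by
  have dim : ∀ (S : Finset (Fin 5)) (m : ℕ) (Q : ℂ[X]) {z : Fin 5 → ℂ → ℂ},
      (∀ i t, (if i ∈ S then t - 1 else t) = z i t) →
      (∀ t, diagPoly (z 0 t) (z 1 t) (z 2 t) (z 3 t) (z 4 t) +
        pathPoly (z 1 t) (z 2 t) (z 3 t) (z 4 t) = t ^ m * Q.eval t) → Q.eval 0 ≠ 0 →
      Module.finrank ℂ (LinearMap.ker (∑ i ∈ S, A i).mulVecLin) = m * k := by
    intro S m Q z hz hQ hQ0
    refine finrank_ker_of_det_eq_pow hA hsum hc hdet (fun t ↦ ?_) hQ0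
    simp only [hz]
    exact hQ t
  -- Each polynomial below is `4 e₁ e₃ + N` at the point `t • 1 - 1_S`, divided by `t ^ m`.
  have hA' := dim {0} 2 (4 * (5 * X - 1) * (10 * X - 6) + 3 * X ^ 2)
    (z := ![fun t ↦ t - 1, id, id, id, id])
    (by simp [Fin.forall_fin_succ]) (fun t ↦ by simp [diagPoly, pathPoly]; ring) (by norm_num)
  have hB := dim {2} 2 (4 * (5 * X - 1) * (10 * X - 6) + 2 * X ^ 2 + (X - 1) ^ 2)
    (z := ![id, id, fun t ↦ t - 1, id, id])
    (by simp [Fin.forall_fin_succ]) (fun t ↦ by simp [diagPoly, pathPoly]; ring) (by norm_num)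
  have hC := dim {1} 2 (4 * (5 * X - 1) * (10 * X - 6) + X ^ 2 + 2 * (X - 1) ^ 2)
    (z := ![id, fun t ↦ t - 1, id, id, id])
    (by simp [Fin.forall_fin_succ]) (fun t ↦ by simp [diagPoly, pathPoly]; ring) (by norm_num)
  have hD := dim {3} 2 (4 * (5 * X - 1) * (10 * X - 6) + 2 * X ^ 2 + (X - 1) ^ 2)
    (z := ![id, id, id, fun t ↦ t - 1, id])
    (by simp [Fin.forall_fin_succ]) (fun t ↦ by simp [diagPoly, pathPoly]; ring) (by norm_num)
  have hAB := dim ({0} ∪ {2}) 1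
    (4 * (5 * X - 2) * (10 * X ^ 2 - 12 * X + 3) + 2 * X ^ 3 + X * (X - 1) ^ 2)
    (z := ![fun t ↦ t - 1, id, fun t ↦ t - 1, id, id])
    (by simp [Fin.forall_fin_succ]) (fun t ↦ by simp [diagPoly, pathPoly]; ring) (by norm_num)
  have hAC := dim ({0} ∪ {1}) 1
    (4 * (5 * X - 2) * (10 * X ^ 2 - 12 * X + 3) + X ^ 3 + 2 * X * (X - 1) ^ 2)
    (z := ![fun t ↦ t - 1, fun t ↦ t - 1, id, id, id])
    (by simp [Fin.forall_fin_succ]) (fun t ↦ by simp [diagPoly, pathPoly]; ring) (by norm_num)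
  have hBC := dim ({2} ∪ {1}) 1
    (4 * (5 * X - 2) * (10 * X ^ 2 - 12 * X + 3) + 3 * X * (X - 1) ^ 2)
    (z := ![id, fun t ↦ t - 1, fun t ↦ t - 1, id, id])
    (by simp [Fin.forall_fin_succ]) (fun t ↦ by simp [diagPoly, pathPoly]; ring) (by norm_num)
  have hAD := dim ({0} ∪ {3}) 1
    (4 * (5 * X - 2) * (10 * X ^ 2 - 12 * X + 3) + 2 * X ^ 3 + X * (X - 1) ^ 2)
    (z := ![fun t ↦ t - 1, id, id, fun t ↦ t - 1, id])
    (by simp [Fin.forall_fin_succ]) (fun t ↦ by simp [diagPoly, pathPoly]; ring) (by norm_num)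
  have hBD := dim ({2} ∪ {3}) 1
    (4 * (5 * X - 2) * (10 * X ^ 2 - 12 * X + 3) + X ^ 3 + 2 * X * (X - 1) ^ 2)
    (z := ![id, id, fun t ↦ t - 1, fun t ↦ t - 1, id])
    (by simp [Fin.forall_fin_succ]) (fun t ↦ by simp [diagPoly, pathPoly]; ring) (by norm_num)
  have hABC := dim ({0} ∪ {2} ∪ {1}) 0
    (4 * (5 * X - 3) * (10 * X ^ 3 - 18 * X ^ 2 + 9 * X - 1) +
      3 * (X * (X - 1)) ^ 2)
    (z := ![fun t ↦ t - 1, fun t ↦ t - 1, fun t ↦ t - 1, id, id])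
    (by simp [Fin.forall_fin_succ]) (fun t ↦ by simp [diagPoly, pathPoly]; ring) (by norm_num)
  have hABD := dim ({0} ∪ {2} ∪ {3}) 0
    (4 * (5 * X - 3) * (10 * X ^ 3 - 18 * X ^ 2 + 9 * X - 1) + X ^ 4 +
      2 * (X * (X - 1)) ^ 2)
    (z := ![fun t ↦ t - 1, id, fun t ↦ t - 1, fun t ↦ t - 1, id])
    (by simp [Fin.forall_fin_succ]) (fun t ↦ by simp [diagPoly, pathPoly]; ring) (by norm_num)
  have hCD := dim ({1} ∪ {3}) 0
    (4 * (5 * X - 2) * X * (10 * X ^ 2 - 12 * X + 3) + (X - 1) ^ 4 +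
      (X * (X - 1)) ^ 2 + X ^ 4)
    (z := ![id, fun t ↦ t - 1, id, fun t ↦ t - 1, id])
    (by simp [Fin.forall_fin_succ]) (fun t ↦ by simp [diagPoly, pathPoly]; ring) (by norm_num)
  rw [Matrix.PosSemidef.ker_mulVecLin_sum_union hA (by decide)] at hAB hAC hBC hAD hBD hCD
  rw [Matrix.PosSemidef.ker_mulVecLin_sum_union hA (by decide),
    Matrix.PosSemidef.ker_mulVecLin_sum_union hA (by decide), zero_mul,
    Submodule.finrank_eq_zero] at hABC hABD
  rw [zero_mul, Submodule.finrank_eq_zero] at hCD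
  rw [one_mul] at hAB hAC hBC hAD hBD
  exact Submodule.no_dual_vamos_configuration hk hA' hB hC hD hAB hAC hBC hAD hBD hABC hABD hCD

theorem vamosTenPoly_pow_not_hasDefiniteDetRep {k : ℕ} (hk : 1 ≤ k) :
    ¬ (vamosTenPoly ^ k).HasDefiniteDetRep := by
  rintro ⟨d, A, hA, hrep⟩
  have hdet : ∀ x : Fin 10 → ℂ, (∑ i, x i • A i).det =
      (MvPolynomial.aeval x vamosTenPoly) ^ k := by
    intro x
    have h := congrArg (MvPolynomial.eval x) hrep
    rw [RingHom.map_det, MvPolynomial.eval_map] at h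
    have hr : (MvPolynomial.eval x).mapMatrix
        (∑ i, (MvPolynomial.X i : MvPolynomial (Fin 10) ℂ) • (A i).map MvPolynomial.C) =
        ∑ i, x i • A i := by
      ext p q
      simp [Matrix.sum_apply]
    rw [hr] at h
    rw [← h, ← map_pow]
    rfl
  set B : Fin 5 → Matrix (Fin d) (Fin d) ℂ :=
    ![A 0 + A 1, A 2 + A 3, A 4 + A 5, A 6 + A 7, A 8 + A 9] with hB
  have hBpos : ∀ i, (B i).PosSemidef := by
    simp [Fin.forall_fin_succ, hB, Matrix.PosSemidef.add, hA]
  have hBdet : ∀ z : Fin 5 → ℂ, (∑ i, z i • B i).det =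
      (diagPoly (z 0) (z 1) (z 2) (z 3) (z 4) + pathPoly (z 1) (z 2) (z 3) (z 4)) ^ k := by
    intro z
    have hz : ∑ i, z i • B i =
        ∑ i, (![z 0, z 0, z 1, z 1, z 2, z 2, z 3, z 3, z 4, z 4] : Fin 10 → ℂ) i • A i := by
      simp only [Fin.sum_univ_succ, hB]
      simp [smul_add, add_assoc]
    rw [hz, hdet, aeval_vamosTenPoly]
    congr 1
    simp [pairPoly, diagPoly, pathPoly]
    ring
  have hBsum : (∑ i, B i).det ≠ 0 := by
    have := hBdet fun _ ↦ 1
    simp only [one_smul] at this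
    rw [this]
    exact pow_ne_zero _ (by norm_num [diagPoly, pathPoly])
  obtain ⟨B', hB', hsum, c, hc, hdet'⟩ := exists_normalized_det_rep hBpos hBsum
  exact not_exists_normalized_pencil hk hB' hsum hc fun z ↦ by rw [hdet', hBdet]

theorem theorem1p1 :
    (∃ M : Matroid (Fin 10), M.E = Set.univ ∧
        (∀ S : Set (Fin 10), M.IsBase S ↔ ∃ B ∈ vamosTenBases, (B : Set (Fin 10)) = S) ∧
        M.eRank = 4 ∧ M.basisGenPoly = vamosTenPoly ∧ M.HasHalfPlaneProperty) ∧
      vamosTenPoly.IsHomogeneous 4 ∧ vamosTenPoly.IsStable ∧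
      ∀ k : ℕ, 1 ≤ k → ¬ (vamosTenPoly ^ k).HasDefiniteDetRep := by
  have hM := vamosTenMatroid.basisGenPoly_eq_sum vamosTenBases vamosTenMatroid_isBase
  refine ⟨⟨vamosTenMatroid, rfl, vamosTenMatroid_isBase, vamosTenMatroid_eRank, hM, ?_⟩,
    vamosTenPoly_isHomogeneous, vamosTenPoly_isStable,
    fun k hk ↦ vamosTenPoly_pow_not_hasDefiniteDetRep hk⟩
  rw [Matroid.HasHalfPlaneProperty, hM]
  exact vamosTenPoly_isStable
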